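/- Theorem 1.2. There is a universal constant $c>0$ such that the following holds. Let $d_{\mathrm{in}}\ge 1$ and $d_{\mathrm{out}}\ge 2$ be integers, let $\theta\in\mathbb C^{d_{\mathrm{out}}\times d_{\mathrm{out}}}$ be a pure state (i.e. $\theta=|v\rangle\langle v|$ for a unit vector $v$), let $\mathcal N:\mathbb C^{d_{\mathrm{in}}\times d_{\mathrm{in}}}\to\mathbb C^{d_{\mathrm{out}}\times d_{\mathrm{out}}}$ be the pure-state replacement channel $\mathcal N(X)=\operatorname{tr}(X)\,\theta$, and let $0<\varepsilon\le 2$. Suppose that an ancilla-assisted, coherent, adaptive tester making $n$ queries decides with success probability at least $2/3$ whether an unknown channel $\mathcal M:\mathbb C^{d_{\mathrm{in}}\times d_{\mathrm{in}}}\to\mathbb C^{d_{\mathrm{out}}\times d_{\mathrm{out}}}$ satisfies $\mathcal M=\mathcal N$ or $\|\mathcal M-\mathcal N\|_\diamond\ge\varepsilon$; that is, it accepts with probability at least $2/3$ if $\mathcal M=\mathcal N$, and rejects with probability at least $2/3$ for every channel $\mathcal M$ with $\|\mathcal M-\mathcal N\|_\diamond\ge\varepsilon$. Then $$n\;\ge\;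 c\,\frac{d_{\mathrm{in}}}{\varepsilon}.$$ Here a channel is a completely positive, trace-preserving linear map between matrix spaces, and $\|\mathcal L\|_\diamond=\max_{\|X\|_1\le 1}\|(\mathcal L\otimes\mathcal I_{d_{\mathrm{in}}})(X)\|_1$, where $\|\cdot\|_1$ is the sum of the singular values. A deterministic ancilla-assisted, coherent, adaptive tester making $n$ queries consists of an ancilla dimension $d_{\mathrm{anc}}\ge 1$, channels $\mathcal V_1,\dots,\mathcal V_n$ from matrices on $\mathbb C^{d_{\mathrm{out}}}\otimes\mathbb C^{d_{\mathrm{anc}}}$ to matrices on $\mathbb C^{d_{\mathrm{in}}}\otimes\mathbb C^{d_{\mathrm{anc}}}$, and a two-outcome POVM $(P_{\mathrm{accept}},P_{\mathrm{reject}})$ on $\mathbb C^{d_{\mathrm{out}}}\otimes\mathbb C^{d_{\mathrm{anc}}}$; on a channel $\mathcal M$ it measures this POVM on the state $(\mathcal M\otimes\mathcal I)\mathcal V_n(\mathcal M\otimes\mathcal I)\mathcal V_{n-1}\cdots(\mathcal M\otimes\mathcal I)\mathcal V_1(|0\rangle\langle 0|)$ and accepts or rejects according to the outcome. A tester may be randomized,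 i.e. a random choice of a deterministic tester making $n$ queries, and its success probability is over this choice and over the outcome of the measurement. -/

import Mathlib

open MeasureTheory
open scoped ComplexOrder

noncomputable section

namespace ChannelTesting

/-- A superoperator: a linear transformation from `m × m` complex matrices to `n × n` complex
matrices. -/
abbrev Superoperator (m n : Type*) : Type _ :=
  Matrix m m ℂ →ₗ[ℂ] Matrix n n ℂ

/-- The trivial extension `L ⊗ I` of a superoperator `L`, where `I` is the identity superoperator
on `k × k` matrices. The space `ℂ^m ⊗ ℂ^k` is indexed by `m × k`, and `L` is applied to each of
the blocks `X_{(·, i), (·, j)}`. -/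
def tensorId {m n : Type*} (k : Type*) (L : Superoperator m n) :
    Superoperator (m × k) (n × k) where
  toFun X := Matrix.of fun a b => L (Matrix.of fun p q => X (p, a.2) (q, b.2)) a.1 b.1
  map_add' X Y := by
    ext a b
    have h : (Matrix.of fun p q => (X + Y) (p, a.2) (q, b.2) : Matrix m m ℂ) =
        (Matrix.of fun p q => X (p, a.2) (q, b.2)) + Matrix.of fun p q => Y (p, a.2) (q, b.2) :=
      rfl
    exact (congrFun₂ (congrArg L h) a.1 b.1).trans (congrFun₂ (map_add L _ _) a.1 b.1)
  map_smul' c X := by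
    ext a b
    have h : (Matrix.of fun p q => (c • X) (p, a.2) (q, b.2) : Matrix m m ℂ) =
        c • Matrix.of fun p q => X (p, a.2) (q, b.2) :=
      rfl
    exact (congrFun₂ (congrArg L h) a.1 b.1).trans (congrFun₂ (map_smul L c _) a.1 b.1)

/-- On product matrices, `(L ⊗ I)(A ⊗ B) = L(A) ⊗ B`; this characterizes `L ⊗ I`. -/
theorem tensorId_kronecker {m n k : Type*} (L : Superoperator m n) (A : Matrix m m ℂ)
    (B : Matrix k k ℂ) :
    tensorId k L (Matrix.kronecker A B) = Matrix.kronecker (L A) B := by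
  ext a b
  have h : (Matrix.of fun p q => Matrix.kronecker A B (p, a.2) (q, b.2) : Matrix m m ℂ) =
      B a.2 b.2 • A := by
    ext p q
    simp [Matrix.kronecker, Matrix.kroneckerMap_apply, mul_comm]
  refine (congrFun₂ ((congrArg L h).trans (map_smul L _ A)) a.1 b.1).trans ?_
  simp [Matrix.kronecker, Matrix.kroneckerMap_apply, mul_comm]

/-- `L` is completely positive: for every `k`, the superoperator `L ⊗ I_k` maps positive
semidefinite matrices to positive semidefinite matrices. -/
def IsCompletelyPositive {m n : Type*} (L : Superoperator m n) : Prop :=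
  ∀ (k : ℕ) (X : Matrix (m × Fin k) (m × Fin k) ℂ),
    X.PosSemidef → (tensorId (Fin k) L X).PosSemidef

/-- `L` is trace-preserving. -/
def IsTracePreserving {m n : Type*} [Fintype m] [Fintype n] (L : Superoperator m n) : Prop :=
  ∀ X : Matrix m m ℂ, (L X).trace = X.trace

/-- A quantum channel is a completely positive, trace-preserving superoperator. -/
structure IsChannel {m n : Type*} [Fintype m] [Fintype n] (L : Superoperator m n) : Prop where
  completelyPositive : IsCompletelyPositive L
  tracePreserving : IsTracePreserving L

/-- The trace norm `‖A‖₁`: the sum of the singular values of `A`, i.e. of the square roots of the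
eigenvalues (with multiplicity) of `Aᴴ A`. -/
def traceNorm {n : Type*} [Fintype n] [DecidableEq n] (A : Matrix n n ℂ) : ℝ :=
  ∑ i, √((Matrix.isHermitian_conjTranspose_mul_self A).eigenvalues i)

/-- The diamond norm `‖L‖_⋄ = max { ‖(L ⊗ I) X‖₁ : ‖X‖₁ ≤ 1 }`, where `I` is the identity
superoperator on matrices of the same size as the inputs of `L`. -/
def diamondNorm {m n : Type*} [Fintype m] [DecidableEq m] [Fintype n] [DecidableEq n]
    (L : Superoperator m n) : ℝ :=
  sSup ((fun X : Matrix (m × m) (m × m) ℂ => traceNorm (tensorId m L X)) ''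
    {X | traceNorm X ≤ 1})

/-- A pure state, as a rank-one density matrix: `θ = |v⟩⟨v|` for a unit vector `v`. -/
def IsPureState {n : Type*} [Fintype n] (θ : Matrix n n ℂ) : Prop :=
  ∃ v : n → ℂ, star v ⬝ᵥ v = 1 ∧ θ = Matrix.vecMulVec v (star v)

/-- The replacement superoperator `X ↦ tr(X) θ`. -/
def replacement (m : Type*) {n : Type*} [Fintype m] (θ : Matrix n n ℂ) : Superoperator m n :=
  (Matrix.traceLinearMap m ℂ ℂ).smulRight θ

/-- A deterministic ancilla-assisted, coherent, adaptive channel tester making `n` queries to a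
channel with input dimension `din` and output dimension `dout`: an ancilla of arbitrary (positive,
finite) dimension, one channel to be applied before each query, and a two-outcome POVM. -/
structure AdaptiveTester (din dout n : ℕ) where
  /-- the dimension of the ancilla -/
  anc : ℕ
  anc_pos : 0 < anc
  /-- `V j` is applied before the `j`-th query (counted from `0`) -/
  V : Fin n → Superoperator (Fin dout × Fin anc) (Fin din × Fin anc)
  isChannel_V : ∀ j, IsChannel (V j)
  /-- the POVM element for the outcome "accept" -/
  accept : Matrix (Fin dout × Fin anc) (Fin dout × Fin anc) ℂ
  /-- the POVM element for the outcome "reject" -/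
  reject : Matrix (Fin dout × Fin anc) (Fin dout × Fin anc) ℂ
  accept_posSemidef : accept.PosSemidef
  reject_posSemidef : reject.PosSemidef
  accept_add_reject : accept + reject = 1

namespace AdaptiveTester

variable {din dout n : ℕ} (T : AdaptiveTester din dout n)

/-- The initial state `|0⟩⟨0|` of the tester. -/
def initialState : Matrix (Fin dout × Fin T.anc) (Fin dout × Fin T.anc) ℂ :=
  Matrix.diagonal fun i => if (i.1 : ℕ) = 0 ∧ (i.2 : ℕ) = 0 then 1 else 0

/-- The state `(M ⊗ I) V_n (M ⊗ I) V_{n-1} ⋯ (M ⊗ I) V_1 (|0⟩⟨0|)` that the tester measures when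
it queries `M`. -/
def finalState (M : Superoperator (Fin din) (Fin dout)) :
    Matrix (Fin dout × Fin T.anc) (Fin dout × Fin T.anc) ℂ :=
  Fin.foldl n (fun ρ j => tensorId (Fin T.anc) M (T.V j ρ)) T.initialState

/-- The probability that the tester accepts the channel `M`. -/
def acceptProb (M : Superoperator (Fin din) (Fin dout)) : ℝ :=
  ((T.accept * T.finalState M).trace).re

/-- The probability that the tester rejects the channel `M`. -/
def rejectProb (M : Superoperator (Fin din) (Fin dout)) : ℝ :=
  ((T.reject * T.finalState M).trace).re

end AdaptiveTester

/-- A (possibly randomized) ancilla-assisted, coherent, adaptive channel tester making `n` queries: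
a random deterministic tester making `n` queries. The ancilla dimension may be random too. All that
is asked of the randomness is that, for every channel, the probabilities of the two outcomes be
random variables. A finite or countable convex combination of deterministic testers is the case of
a discrete space `Ω`, and a deterministic tester is the case of a one-point space. -/
structure RandomizedTester (din dout n : ℕ) where
  Ω : Type
  [measurableSpace : MeasurableSpace Ω]
  P : Measure Ω
  [isProbabilityMeasure : IsProbabilityMeasure P]
  tester : Ω → AdaptiveTester din dout n
  measurable_acceptProb : ∀ M, IsChannel M → Measurable fun ω => (tester ω).acceptProb M
  measurable_rejectProb : ∀ M, IsChannel M → Measurable fun ω => (tester ω).rejectProb M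

namespace RandomizedTester

attribute [instance] measurableSpace isProbabilityMeasure

variable {din dout n : ℕ} (T : RandomizedTester din dout n)

/-- The probability, over the choice of the deterministic tester and over the outcome of its
measurement, that the tester accepts the channel `M`. -/
def acceptProb (M : Superoperator (Fin din) (Fin dout)) : ℝ :=
  ∫ ω, (T.tester ω).acceptProb M ∂T.P

/-- The probability, over the choice of the deterministic tester and over the outcome of its
measurement, that the tester rejects the channel `M`. -/
def rejectProb (M : Superoperator (Fin din) (Fin dout)) : ℝ :=
  ∫ ω, (T.tester ω).rejectProb M ∂T.P

/-- `T` decides whether `M = N` or `‖M - N‖_⋄ ≥ ε` with success probability at least `2/3`. -/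
structure TestsIdentity (N : Superoperator (Fin din) (Fin dout)) (ε : ℝ) : Prop where
  accepts : 2 / 3 ≤ T.acceptProb N
  rejects : ∀ M : Superoperator (Fin din) (Fin dout), IsChannel M →
    ε ≤ diamondNorm (M - N) → 2 / 3 ≤ T.rejectProb M

end RandomizedTester

end ChannelTesting

end

/-!
The proof exhibits `din` channels, far from the replacement channel `N` in diamond norm, that are on
average hard to tell from `N`. With `θ = |v⟩⟨v|`, choose a unit vector `w` orthogonal to `v` and
let `M_i(X) = tr(X) θ + X_{ii} (ε/2) (|w⟩⟨w| - |v⟩⟨v|)`: the channel that measures its input in the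
standard basis and prepares `θ`, except that on outcome `i` it prepares the mixture of `θ` and
`|w⟩⟨w|` with weights `1 - ε/2` and `ε/2`. The input `E_{ii} ⊗ E_{ii}` shows
`‖M_i - N‖_⋄ ≥ ε` (`le_diamondNorm_perturbed_sub`).

Run a tester on `N` and on `M_i`. Each query to `M_i` differs from a query to `N` by losing at most
`(ε/2) θ ⊗ ⟨i|ρ|i⟩`, up to a positive term, where `ρ` is the input of the query *in the run on
`N`*. Since all later operations are positive and trace-preserving, the state reached with `M_i`
dominates the one reached with `N` up to a positive error of trace `(ε/2) ∑_t tr⟨i|ρ_t|i⟩`.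
The states `ρ_t` do not depend on `i`, so summing over `i` gives total error `n ε/2`
(`exists_domination`). Hence the `din` tests of `N` against `M_i` have success probabilities
`P(accept N) + P(reject M_i)` summing to at most `din + n ε/2`, whereas the hypothesis makes the sum
at least `4 din / 3`; so `n ≥ (2/3) din / ε`.
-/

open MeasureTheory Matrix
open scoped ComplexOrder

namespace ChannelTesting

/-! ### Positive semidefinite matrices and orthogonal unit vectors -/

section Preliminaries

variable {n : Type*} [Fintype n]

open scoped MatrixOrder Matrix.Norms.L2Operator in
theorem re_trace_mul_nonneg {A B : Matrix n n ℂ} (hA : A.PosSemidef) (hB : B.PosSemidef) :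
    0 ≤ ((A * B).trace).re := by
  classical
  obtain ⟨C, rfl⟩ := CStarAlgebra.nonneg_iff_eq_star_mul_self.mp hB.nonneg
  have h : (A * (star C * C)).trace = (C * A * Cᴴ).trace := by
    rw [← Matrix.mul_assoc, Matrix.trace_mul_comm, ← Matrix.mul_assoc, star_eq_conjTranspose]
  rw [h]
  exact (Complex.le_def.mp (hA.mul_mul_conjTranspose_same C).trace_nonneg).1

theorem exists_unit_orthogonal {d : ℕ} (hd : 2 ≤ d) (v : Fin d → ℂ) :
    ∃ w : Fin d → ℂ, star w ⬝ᵥ w = 1 ∧ star v ⬝ᵥ w = 0 := by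
  let f : (Fin d → ℂ) →ₗ[ℂ] ℂ := dotProductBilin ℂ ℂ (star v)
  have hker : LinearMap.ker f ≠ ⊥ := LinearMap.ker_ne_bot_of_finrank_lt (by simp; omega)
  obtain ⟨u, hu, hu0⟩ := Submodule.exists_mem_ne_zero_of_ne_bot hker
  have hu' : star v ⬝ᵥ u = 0 := hu
  have hpos : 0 < star u ⬝ᵥ u := dotProduct_star_self_pos_iff.mpr hu0
  obtain ⟨r, hr, hru⟩ : ∃ r : ℝ, 0 < r ∧ star u ⬝ᵥ u = (r : ℂ) := by
    obtain ⟨h1, h2⟩ := Complex.lt_def.mp hpos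
    exact ⟨_, h1, Complex.ext rfl h2.symm⟩
  refine ⟨((√r)⁻¹ : ℂ) • u, ?_, by rw [dotProduct_smul, hu', smul_zero]⟩
  have hs : ((√r : ℝ) : ℂ) * ((√r : ℝ) : ℂ) = r := by
    rw [← Complex.ofReal_mul, Real.mul_self_sqrt hr.le]
  have hs0 : ((√r : ℝ) : ℂ) ≠ 0 := by exact_mod_cast (Real.sqrt_pos.mpr hr).ne'
  have hst : star (((√r : ℝ) : ℂ)⁻¹) = (((√r : ℝ) : ℂ)⁻¹) := by simp
  rw [star_smul, smul_dotProduct, dotProduct_smul, hru, ← hs, hst, smul_eq_mul, smul_eq_mul]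
  field_simp

end Preliminaries

/-! ### The trace norm and the diamond norm -/

section Norms

variable {n : Type*} [Fintype n] [DecidableEq n]

theorem eigenvalues_conjTranspose_mul_self_nonneg (A : Matrix n n ℂ) (i : n) :
    0 ≤ (isHermitian_conjTranspose_mul_self A).eigenvalues i :=
  (posSemidef_conjTranspose_mul_self A).eigenvalues_nonneg i

theorem traceNorm_nonneg (A : Matrix n n ℂ) : 0 ≤ traceNorm A :=
  Finset.sum_nonneg fun _ _ => Real.sqrt_nonneg _

theorem sum_eigenvalues_conjTranspose_mul_self (A : Matrix n n ℂ) :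
    ∑ i, (isHermitian_conjTranspose_mul_self A).eigenvalues i = ((Aᴴ * A).trace).re := by
  rw [(isHermitian_conjTranspose_mul_self A).trace_eq_sum_eigenvalues]
  simp

omit [DecidableEq n] in
theorem re_trace_conjTranspose_mul_self_eq_sum (A : Matrix n n ℂ) :
    ((Aᴴ * A).trace).re = ∑ i, ∑ j, ‖A j i‖ ^ 2 := by
  simp only [trace, diag, mul_apply, conjTranspose_apply, Complex.re_sum]
  refine Finset.sum_congr rfl fun i _ => Finset.sum_congr rfl fun j _ => ?_
  rw [Complex.star_def, ← Complex.normSq_eq_conj_mul_self, Complex.ofReal_re,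
    Complex.normSq_eq_norm_sq]

theorem norm_apply_le_traceNorm (A : Matrix n n ℂ) (p q : n) : ‖A p q‖ ≤ traceNorm A := by
  refine abs_le_of_sq_le_sq' ?_ (traceNorm_nonneg A) |>.2
  calc ‖A p q‖ ^ 2 ≤ ∑ j, ‖A j q‖ ^ 2 :=
        Finset.single_le_sum (f := fun j => ‖A j q‖ ^ 2) (fun _ _ => by positivity)
          (Finset.mem_univ p)
    _ ≤ ∑ i, ∑ j, ‖A j i‖ ^ 2 :=
        Finset.single_le_sum (f := fun i => ∑ j, ‖A j i‖ ^ 2) (fun _ _ => by positivity)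
          (Finset.mem_univ q)
    _ = ∑ i, √((isHermitian_conjTranspose_mul_self A).eigenvalues i) ^ 2 := by
        rw [← re_trace_conjTranspose_mul_self_eq_sum, ← sum_eigenvalues_conjTranspose_mul_self]
        exact Finset.sum_congr rfl fun i _ =>
          (Real.sq_sqrt (eigenvalues_conjTranspose_mul_self_nonneg A i)).symm
    _ ≤ traceNorm A ^ 2 :=
        Finset.sum_sq_le_sq_sum_of_nonneg fun _ _ => Real.sqrt_nonneg _

theorem traceNorm_le_of_norm_apply_le {A : Matrix n n ℂ} {C : ℝ} (h : ∀ p q, ‖A p q‖ ≤ C) :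
    traceNorm A ≤ ∑ _i : n, √(∑ _i : n, ∑ _j : n, C ^ 2) := by
  refine Finset.sum_le_sum fun k _ => Real.sqrt_le_sqrt ?_
  calc (isHermitian_conjTranspose_mul_self A).eigenvalues k
      ≤ ∑ i, (isHermitian_conjTranspose_mul_self A).eigenvalues i :=
        Finset.single_le_sum (fun i _ => eigenvalues_conjTranspose_mul_self_nonneg A i)
          (Finset.mem_univ k)
    _ = ∑ i, ∑ j, ‖A j i‖ ^ 2 := by
        rw [sum_eigenvalues_conjTranspose_mul_self, re_trace_conjTranspose_mul_self_eq_sum]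
    _ ≤ _ := by gcongr; exact h _ _

/-- If `AᴴA` is `c²` times a projection, then every singular value of `A` is `0` or `c`. -/
theorem mul_traceNorm_eq_of_mul_self {A : Matrix n n ℂ} {c : ℝ} (hc : 0 ≤ c)
    (h : (Aᴴ * A) * (Aᴴ * A) = ((c : ℂ) ^ 2) • (Aᴴ * A)) :
    c * traceNorm A = ((Aᴴ * A).trace).re := by
  rw [← sum_eigenvalues_conjTranspose_mul_self, traceNorm, Finset.mul_sum]
  refine Finset.sum_congr rfl fun i _ => ?_
  set hA := isHermitian_conjTranspose_mul_self A
  set l := hA.eigenvalues i with hl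
  set u : n → ℂ := ⇑(hA.eigenvectorBasis i)
  have hu : (Aᴴ * A) *ᵥ u = (l : ℂ) • u := by
    have := hA.mulVec_eigenvectorBasis i
    rw [this]
    ext
    simp [u, hl]
  have hu0 : u ≠ 0 := fun h0 =>
    hA.eigenvectorBasis.orthonormal.ne_zero i (by ext j; exact congrFun h0 j)
  have h2 : ((l : ℂ) * l) • u = ((c : ℂ) ^ 2 * l) • u := by
    rw [mul_smul, mul_smul, ← hu, ← mulVec_smul, ← hu, mulVec_mulVec, h, smul_mulVec]
  have h3 : l * l = c ^ 2 * l := by exact_mod_cast smul_left_injective ℂ hu0 h2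
  have hl0 : 0 ≤ l := eigenvalues_conjTranspose_mul_self_nonneg A i
  rcases hl0.eq_or_lt with h0 | h0
  · rw [← h0]; simp
  · have h4 : l = c ^ 2 := mul_right_cancel₀ h0.ne' h3
    rw [h4, Real.sqrt_sq hc, sq]

/-- The set whose supremum defines the diamond norm is bounded, so that the supremum is not the
junk value `0`. -/
theorem bddAbove_diamondNorm {m : Type*} [Fintype m] [DecidableEq m] (L : Superoperator m n) :
    BddAbove ((fun X : Matrix (m × m) (m × m) ℂ => traceNorm (tensorId m L X)) ''
      {X | traceNorm X ≤ 1}) := by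
  refine ⟨∑ _i : n × m, √(∑ _i : n × m, ∑ _j : n × m,
    (∑ r, ∑ s, ∑ a, ∑ b, ‖tensorId m L (single r s 1) a b‖) ^ 2), ?_⟩
  rintro _ ⟨X, hX, rfl⟩
  refine traceNorm_le_of_norm_apply_le fun p q => ?_
  have hexp : tensorId m L X = ∑ r, ∑ s, X r s • tensorId m L (single r s 1) := by
    conv_lhs => rw [matrix_eq_sum_single X]
    simp only [map_sum]
    refine Finset.sum_congr rfl fun r _ => Finset.sum_congr rfl fun s _ => ?_
    rw [← map_smul, smul_single, smul_eq_mul, mul_one]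
  simp only [hexp, Matrix.sum_apply, Matrix.smul_apply, smul_eq_mul]
  refine (norm_sum_le _ _).trans (Finset.sum_le_sum fun r _ => ?_)
  refine (norm_sum_le _ _).trans (Finset.sum_le_sum fun s _ => ?_)
  rw [norm_mul]
  calc ‖X r s‖ * ‖tensorId m L (single r s 1) p q‖
      ≤ 1 * ‖tensorId m L (single r s 1) p q‖ := by
        gcongr; exact (norm_apply_le_traceNorm X r s).trans hX
    _ ≤ ∑ b, ‖tensorId m L (single r s 1) p b‖ := by
        rw [one_mul]
        exact Finset.single_le_sum (f := fun b => ‖tensorId m L (single r s 1) p b‖)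
          (fun _ _ => norm_nonneg _) (Finset.mem_univ q)
    _ ≤ ∑ a, ∑ b, ‖tensorId m L (single r s 1) a b‖ :=
        Finset.single_le_sum (f := fun a => ∑ b, ‖tensorId m L (single r s 1) a b‖)
          (fun _ _ => by positivity) (Finset.mem_univ p)

end Norms

/-! ### Channels -/

section Channels

variable {m n k : Type*} [Fintype m] [Fintype n] [Fintype k]

omit [Fintype n] in
/-- Complete positivity with a one-dimensional ancilla is positivity. -/
theorem IsCompletelyPositive.posSemidef {L : Superoperator m n} (hL : IsCompletelyPositive L)
    {X : Matrix m m ℂ} (hX : X.PosSemidef) : (L X).PosSemidef := by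
  have h := hL 1 _ (hX.kronecker (PosSemidef.one : (1 : Matrix (Fin 1) (Fin 1) ℂ).PosSemidef))
  have h' := tensorId_kronecker L X (1 : Matrix (Fin 1) (Fin 1) ℂ)
  have e : L X = (tensorId (Fin 1) L (Matrix.kronecker X (1 : Matrix (Fin 1) (Fin 1) ℂ))).submatrix
      (fun a => (a, 0)) (fun a => (a, 0)) := by
    rw [h']
    ext a b
    simp [Matrix.kronecker, kroneckerMap_apply]
  rw [e]
  exact h.submatrix _

theorem IsTracePreserving.tensorId {L : Superoperator m n} (hL : IsTracePreserving L) :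
    IsTracePreserving (tensorId k L) := by
  intro X
  have h (i : k) := hL (Matrix.of fun p q => X (p, i) (q, i))
  simp only [trace, diag, Fintype.sum_prod_type_right] at h ⊢
  exact Finset.sum_congr rfl fun i _ => h i

/-- The superoperator `X ↦ ∑ j, X_{jj} τ_j`: measure in the standard basis and prepare `τ_j` on
outcome `j`. -/
noncomputable def measurePrepare (τ : m → Matrix n n ℂ) : Superoperator m n :=
  ∑ j, (entryLinearMap ℂ ℂ j j).smulRight (τ j)

omit [Fintype n] in
theorem measurePrepare_apply (τ : m → Matrix n n ℂ) (X : Matrix m m ℂ) :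
    measurePrepare τ X = ∑ j, X j j • τ j := by
  simp [measurePrepare]

omit [Fintype n] in
theorem replacement_eq_measurePrepare (θ : Matrix n n ℂ) :
    replacement m θ = measurePrepare fun _ => θ := by
  refine LinearMap.ext fun X => ?_
  rw [measurePrepare_apply, ← Finset.sum_smul]
  rfl

omit [Fintype n] [Fintype k] in
theorem tensorId_measurePrepare (τ : m → Matrix n n ℂ) (X : Matrix (m × k) (m × k) ℂ) :
    tensorId k (measurePrepare τ) X =
      ∑ j, Matrix.kronecker (τ j) (X.submatrix (Prod.mk j) (Prod.mk j)) := by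
  ext a b
  refine (congrFun₂ (measurePrepare_apply τ _) a.1 b.1).trans ?_
  simp only [Matrix.sum_apply, Matrix.smul_apply, smul_eq_mul, Matrix.kronecker, kroneckerMap_apply,
    submatrix_apply, of_apply]
  exact Finset.sum_congr rfl fun j _ => mul_comm _ _

theorem posSemidef_tensorId_measurePrepare {τ : m → Matrix n n ℂ} (hτ : ∀ j, (τ j).PosSemidef)
    {X : Matrix (m × k) (m × k) ℂ} (hX : X.PosSemidef) :
    (tensorId k (measurePrepare τ) X).PosSemidef := by
  rw [tensorId_measurePrepare]
  exact posSemidef_sum _ fun j _ => (hτ j).kronecker (hX.submatrix _)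

theorem isChannel_measurePrepare {τ : m → Matrix n n ℂ} (hτ : ∀ j, (τ j).PosSemidef)
    (htr : ∀ j, (τ j).trace = 1) : IsChannel (measurePrepare τ) where
  completelyPositive _ _ hX := posSemidef_tensorId_measurePrepare hτ hX
  tracePreserving X := by
    simp only [measurePrepare_apply, trace_sum, trace_smul, htr, smul_eq_mul, mul_one]
    rfl

/-- The perturbation of the replacement channel of `θ` that, on outcome `i` of a measurement in the
standard basis, prepares `(1 - a) θ + a ω` instead of `θ`. -/
noncomputable def perturbed [DecidableEq m] (θ ω : Matrix n n ℂ) (a : ℝ) (i : m) :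
    Superoperator m n :=
  measurePrepare (Function.update (fun _ => θ) i ((1 - a) • θ + a • ω))

variable [DecidableEq m]

omit [Fintype n] in
theorem perturbed_apply (θ ω : Matrix n n ℂ) (a : ℝ) (i : m) (X : Matrix m m ℂ) :
    perturbed θ ω a i X = replacement m θ X + X i i • a • (ω - θ) := by
  rw [perturbed, replacement_eq_measurePrepare, measurePrepare_apply, measurePrepare_apply,
    ← sub_eq_iff_eq_add', ← Finset.sum_sub_distrib, Finset.sum_eq_single i]
  · rw [Function.update_self, ← smul_sub]
    congr 1
    module
  · intro j _ hj
    rw [Function.update_of_ne hj, sub_self]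
  · simp

omit [Fintype n] [Fintype k] in
theorem tensorId_perturbed (θ ω : Matrix n n ℂ) (a : ℝ) (i : m) (X : Matrix (m × k) (m × k) ℂ) :
    tensorId k (perturbed θ ω a i) X = tensorId k (replacement m θ) X +
      Matrix.kronecker (a • (ω - θ)) (X.submatrix (Prod.mk i) (Prod.mk i)) := by
  ext p q
  refine (congrFun₂ (perturbed_apply θ ω a i _) p.1 q.1).trans ?_
  rw [Matrix.add_apply, Matrix.add_apply]
  congr 1
  exact mul_comm _ _

omit [Fintype m] [Fintype n] in
theorem posSemidef_update_mixture {θ ω : Matrix n n ℂ} (hθ : θ.PosSemidef) (hω : ω.PosSemidef)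
    {a : ℝ} (h0 : 0 ≤ a) (h1 : a ≤ 1) (i j : m) :
    (Function.update (fun _ => θ) i ((1 - a) • θ + a • ω) j).PosSemidef := by
  rcases eq_or_ne j i with rfl | hj
  · rw [Function.update_self]
    exact (hθ.smul (sub_nonneg.mpr h1)).add (hω.smul h0)
  · rwa [Function.update_of_ne hj]

theorem isChannel_perturbed {θ ω : Matrix n n ℂ} (hθ : θ.PosSemidef) (hω : ω.PosSemidef)
    (hθ1 : θ.trace = 1) (hω1 : ω.trace = 1) {a : ℝ} (h0 : 0 ≤ a) (h1 : a ≤ 1) (i : m) :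
    IsChannel (perturbed θ ω a i) := by
  refine isChannel_measurePrepare (posSemidef_update_mixture hθ hω h0 h1 i) fun j => ?_
  rcases eq_or_ne j i with rfl | hj
  · rw [Function.update_self, trace_add, trace_smul, trace_smul, hθ1, hω1, ← add_smul]
    simp
  · rwa [Function.update_of_ne hj]

/-- The perturbed channel is at diamond distance at least `2a` from the replacement channel, if the
two states are orthogonal projections of trace one. -/
theorem le_diamondNorm_perturbed_sub [DecidableEq n] {θ ω : Matrix n n ℂ} (hθ : θ.IsHermitian)
    (hω : ω.IsHermitian) (hθθ : θ * θ = θ) (hωω : ω * ω = ω) (hθω : θ * ω = 0) (hωθ : ω * θ = 0)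
    (hθ1 : θ.trace = 1) (hω1 : ω.trace = 1) {a : ℝ} (ha : 0 < a) (i : m) :
    2 * a ≤ diamondNorm (perturbed θ ω a i - replacement m θ) := by
  set E : Matrix m m ℂ := single i i 1 with hE
  have hEE : E * E = E := by simp [hE]
  have hEh : Eᴴ = E := by simp [hE]
  have hEt : E.trace = 1 := by simp [hE]
  set K : Matrix n n ℂ := (a : ℂ) • (ω - θ) with hK
  have himage : tensorId m (perturbed θ ω a i - replacement m θ) (Matrix.kronecker E E) =
      Matrix.kronecker K E := by
    rw [tensorId_kronecker, LinearMap.sub_apply, perturbed_apply, add_sub_cancel_left]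
    congr 1
    simp only [hE, single_apply_same, one_smul, hK]
    rfl
  have hKh : Kᴴ = K := by
    rw [hK, conjTranspose_smul, conjTranspose_sub, hθ.eq, hω.eq]
    simp
  have hKK : K * K = ((a : ℂ) ^ 2) • (ω + θ) := by
    rw [hK, smul_mul_smul_comm, ← sq]
    congr 1
    simp [mul_sub, sub_mul, hθθ, hωω, hθω, hωθ]
  have hP : (ω + θ) * (ω + θ) = ω + θ := by
    simp [mul_add, add_mul, hθθ, hωω, hθω, hωθ]
  have hX : traceNorm (Matrix.kronecker E E) ≤ 1 := by
    have h1 : (Matrix.kronecker E E)ᴴ * Matrix.kronecker E E = Matrix.kronecker E E := by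
      simp only [Matrix.kronecker]
      rw [conjTranspose_kronecker, hEh, ← mul_kronecker_mul, hEE]
    have h2 := mul_traceNorm_eq_of_mul_self (A := Matrix.kronecker E E) (c := 1) zero_le_one (by
      rw [h1, Complex.ofReal_one, one_pow, one_smul]
      simp only [Matrix.kronecker]
      rw [← mul_kronecker_mul, hEE])
    rw [h1, one_mul] at h2
    simp only [Matrix.kronecker] at h2 ⊢
    rw [h2, trace_kronecker, hEt]
    simp
  have hY : traceNorm (Matrix.kronecker K E) = 2 * a := by
    have h1 : (Matrix.kronecker K E)ᴴ * Matrix.kronecker K E =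
        ((a : ℂ) ^ 2) • Matrix.kronecker (ω + θ) E := by
      simp only [Matrix.kronecker]
      rw [conjTranspose_kronecker, hEh, hKh, ← mul_kronecker_mul, hEE, hKK, smul_kronecker]
    have h2 := mul_traceNorm_eq_of_mul_self (A := Matrix.kronecker K E) (c := a) ha.le (by
      rw [h1, smul_mul_smul_comm, smul_smul]
      simp only [Matrix.kronecker]
      rw [← mul_kronecker_mul, hEE, hP])
    rw [h1, trace_smul] at h2
    simp only [Matrix.kronecker] at h2 ⊢
    rw [trace_kronecker, hEt, trace_add, hθ1, hω1] at h2
    have h3 : a * traceNorm (kroneckerMap (fun x1 x2 => x1 * x2) K E) = a * (2 * a) := by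
      rw [h2]
      have : ((a : ℂ) ^ 2) • ((1 + 1 : ℂ) * 1) = ((a * (2 * a) : ℝ) : ℂ) := by
        push_cast; rw [smul_eq_mul]; ring
      rw [this, Complex.ofReal_re]
    exact mul_left_cancel₀ ha.ne' h3
  rw [← hY, ← himage]
  exact le_csSup (bddAbove_diamondNorm _) ⟨_, hX, rfl⟩

end Channels

/-! ### Comparison of the runs of a tester -/

section Hybrid

variable {m n k : Type*} [Fintype m] [DecidableEq m] [Fintype n] [Fintype k]

/-- The states that a tester reaches with the perturbed channels dominate the one it reaches with
the replacement channel, up to positive semidefinite errors `D i` of total trace `N a`, where `N` is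
the number of queries. -/
theorem exists_domination {θ ω : Matrix n n ℂ} (hθ : θ.PosSemidef) (hω : ω.PosSemidef)
    (hθ1 : θ.trace = 1) (hω1 : ω.trace = 1) {a : ℝ} (h0 : 0 ≤ a) (h1 : a ≤ 1)
    {ρ₀ : Matrix (n × k) (n × k) ℂ} (hρ₀ : ρ₀.PosSemidef) (hρ₀1 : ρ₀.trace = 1) (N : ℕ)
    (V : Fin N → Superoperator (n × k) (m × k)) (hV : ∀ j, IsChannel (V j)) :
    (Fin.foldl N (fun ρ j => tensorId k (replacement m θ) (V j ρ)) ρ₀).PosSemidef ∧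
    (Fin.foldl N (fun ρ j => tensorId k (replacement m θ) (V j ρ)) ρ₀).trace = 1 ∧
    (∀ i, (Fin.foldl N (fun ρ j => tensorId k (perturbed θ ω a i) (V j ρ)) ρ₀).trace = 1) ∧
    ∃ D : m → Matrix (n × k) (n × k) ℂ, (∀ i, (D i).PosSemidef) ∧
      (∀ i, (Fin.foldl N (fun ρ j => tensorId k (perturbed θ ω a i) (V j ρ)) ρ₀ -
        Fin.foldl N (fun ρ j => tensorId k (replacement m θ) (V j ρ)) ρ₀ + D i).PosSemidef) ∧
      ∑ i, (D i).trace = N * a := by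
  have hchan (i : m) := isChannel_perturbed hθ hω hθ1 hω1 h0 h1 i
  have hrep : IsChannel (replacement m θ) := by
    rw [replacement_eq_measurePrepare]
    exact isChannel_measurePrepare (fun _ => hθ) fun _ => hθ1
  have hrepPos {X : Matrix (m × k) (m × k) ℂ} (hX : X.PosSemidef) :
      (tensorId k (replacement m θ) X).PosSemidef := by
    rw [replacement_eq_measurePrepare]
    exact posSemidef_tensorId_measurePrepare (fun _ => hθ) hX
  have hpertPos (i : m) {X : Matrix (m × k) (m × k) ℂ} (hX : X.PosSemidef) :
      (tensorId k (perturbed θ ω a i) X).PosSemidef :=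
    posSemidef_tensorId_measurePrepare (posSemidef_update_mixture hθ hω h0 h1 i) hX
  induction N with
  | zero =>
    refine ⟨by simpa using hρ₀, by simpa using hρ₀1, fun _ => by simpa using hρ₀1,
      fun _ => 0, fun _ => PosSemidef.zero, fun i => ?_, by simp⟩
    simpa using PosSemidef.zero
  | succ N ih =>
    obtain ⟨hρ, hρ1, hσ1, D, hD, hdom, hDtr⟩ :=
      ih (fun j => V j.castSucc) fun j => hV j.castSucc
    simp only [Fin.foldl_succ_last]
    set ρ := Fin.foldl N (fun ρ j => tensorId k (replacement m θ) (V j.castSucc ρ)) ρ₀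
    set σ : m → Matrix (n × k) (n × k) ℂ := fun i =>
      Fin.foldl N (fun ρ j => tensorId k (perturbed θ ω a i) (V j.castSucc ρ)) ρ₀
    set W := V (Fin.last N)
    have hW : IsChannel W := hV _
    have hWρ := hW.completelyPositive.posSemidef hρ
    refine ⟨hrepPos hWρ, ?_, fun i => ?_, fun i => tensorId k (perturbed θ ω a i) (W (D i)) +
      Matrix.kronecker (a • θ) ((W ρ).submatrix (Prod.mk i) (Prod.mk i)), fun i => ?_,
      fun i => ?_, ?_⟩
    · rw [hrep.tracePreserving.tensorId, hW.tracePreserving, hρ1]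
    · rw [(hchan i).tracePreserving.tensorId, hW.tracePreserving]
      exact hσ1 i
    · exact (hpertPos i (hW.completelyPositive.posSemidef (hD i))).add
        ((hθ.smul h0).kronecker (hWρ.submatrix _))
    · -- The perturbed channel applied to the earlier domination, plus the gain
      -- `a ω ⊗ ⟨i|W ρ|i⟩` of the current query.
      have key : tensorId k (perturbed θ ω a i) (W (σ i)) - tensorId k (replacement m θ) (W ρ) +
          (tensorId k (perturbed θ ω a i) (W (D i)) +
            Matrix.kronecker (a • θ) ((W ρ).submatrix (Prod.mk i) (Prod.mk i))) =
          tensorId k (perturbed θ ω a i) (W (σ i - ρ + D i)) +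
            Matrix.kronecker (a • ω) ((W ρ).submatrix (Prod.mk i) (Prod.mk i)) := by
        simp only [map_add, map_sub, tensorId_perturbed θ ω a i (W ρ), smul_sub]
        ext p q
        simp only [Matrix.add_apply, Matrix.sub_apply, Matrix.kronecker, kroneckerMap_apply]
        ring
      exact key ▸ (hpertPos i (hW.completelyPositive.posSemidef (hdom i))).add
        ((hω.smul h0).kronecker (hWρ.submatrix _))
    · have ht (i : m) : (tensorId k (perturbed θ ω a i) (W (D i)) +
          Matrix.kronecker (a • θ) ((W ρ).submatrix (Prod.mk i) (Prod.mk i))).trace =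
          (D i).trace + a * ((W ρ).submatrix (Prod.mk i) (Prod.mk i)).trace := by
        rw [trace_add, (hchan i).tracePreserving.tensorId, hW.tracePreserving]
        simp only [Matrix.kronecker]
        rw [trace_kronecker, trace_smul, hθ1]
        simp
      have hsum : ∑ i, ((W ρ).submatrix (Prod.mk i) (Prod.mk i)).trace = 1 := by
        rw [← hρ1, ← hW.tracePreserving ρ]
        simp only [trace, diag, submatrix_apply, Fintype.sum_prod_type]
      rw [Finset.sum_congr rfl fun i _ => ht i, Finset.sum_add_distrib, hDtr, ← Finset.mul_sum,
        hsum]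
      push_cast
      ring

end Hybrid

namespace AdaptiveTester

variable {din dout n : ℕ} (T : AdaptiveTester din dout n)

theorem posSemidef_initialState : T.initialState.PosSemidef := by
  refine PosSemidef.diagonal fun i => ?_
  dsimp only
  split_ifs <;> simp

theorem trace_initialState (hd : 0 < dout) : T.initialState.trace = 1 := by
  rw [initialState, trace_diagonal, Finset.sum_eq_single (⟨0, hd⟩, ⟨0, T.anc_pos⟩)]
  · simp
  · rintro ⟨x, y⟩ - hxy
    refine if_neg fun h => hxy ?_
    exact Prod.ext (Fin.ext h.1) (Fin.ext h.2)
  · simp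

theorem sum_acceptProb_add_rejectProb_le (hd : 0 < dout) {θ ω : Matrix (Fin dout) (Fin dout) ℂ}
    (hθ : θ.PosSemidef) (hω : ω.PosSemidef) (hθ1 : θ.trace = 1) (hω1 : ω.trace = 1) {a : ℝ}
    (h0 : 0 ≤ a) (h1 : a ≤ 1) :
    ∑ i, (T.acceptProb (replacement (Fin din) θ) + T.rejectProb (perturbed θ ω a i)) ≤
      din + n * a := by
  obtain ⟨-, -, hσ1, D, hD, hdom, hDtr⟩ := exists_domination hθ hω hθ1 hω1 h0 h1
    T.posSemidef_initialState (T.trace_initialState hd) n T.V T.isChannel_V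
  have hi (i : Fin din) : T.acceptProb (replacement (Fin din) θ) +
      T.rejectProb (perturbed θ ω a i) ≤ 1 + ((D i).trace).re := by
    -- Domination gives `P(accept N) ≤ P(accept M_i) + tr(accept * D i)`, and
    -- `tr(accept * D i) ≤ tr(D i)` because `reject` is positive.
    have e1 := re_trace_mul_nonneg T.accept_posSemidef (hdom i)
    have e2 := re_trace_mul_nonneg T.reject_posSemidef (hD i)
    have e3 (X : Matrix (Fin dout × Fin T.anc) (Fin dout × Fin T.anc) ℂ) :
        ((T.accept * X).trace).re + ((T.reject * X).trace).re = (X.trace).re := by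
      rw [← Complex.add_re, ← trace_add, ← add_mul, T.accept_add_reject, one_mul]
    have e4 := e3 (D i)
    have e5 := e3 (T.finalState (perturbed θ ω a i))
    have e6 : (T.finalState (perturbed θ ω a i)).trace = 1 := hσ1 i
    rw [e6, Complex.one_re] at e5
    change 0 ≤ ((T.accept * (T.finalState (perturbed θ ω a i) -
      T.finalState (replacement (Fin din) θ) + D i)).trace).re at e1
    rw [mul_add, mul_sub, trace_add, trace_sub, Complex.add_re, Complex.sub_re] at e1
    simp only [acceptProb, rejectProb]
    linarith
  have hre : ∑ i, ((D i).trace).re = n * a := by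
    rw [← Complex.re_sum, hDtr]
    simp
  calc _ ≤ ∑ i, (1 + ((D i).trace).re) := Finset.sum_le_sum fun i _ => hi i
    _ = din + n * a := by
      rw [Finset.sum_add_distrib, hre]
      simp

end AdaptiveTester

namespace RandomizedTester

variable {din dout n : ℕ} (T : RandomizedTester din dout n)

/-- A tester's guarantee forces integrability: otherwise the Bochner integrals would be `0`. -/
theorem integrable_of_two_thirds_le {Ω : Type*} [MeasurableSpace Ω] {P : Measure Ω} {f : Ω → ℝ}
    (h : 2 / 3 ≤ ∫ x, f x ∂P) : Integrable f P := by
  by_contra hf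
  rw [integral_undef hf] at h
  norm_num at h

theorem sum_acceptProb_add_rejectProb_le (hd : 0 < dout) {θ ω : Matrix (Fin dout) (Fin dout) ℂ}
    (hθ : θ.PosSemidef) (hω : ω.PosSemidef) (hθ1 : θ.trace = 1) (hω1 : ω.trace = 1) {a : ℝ}
    (h0 : 0 ≤ a) (h1 : a ≤ 1) (hN : 2 / 3 ≤ T.acceptProb (replacement (Fin din) θ))
    (hM : ∀ i, 2 / 3 ≤ T.rejectProb (perturbed θ ω a i)) :
    ∑ i, (T.acceptProb (replacement (Fin din) θ) + T.rejectProb (perturbed θ ω a i)) ≤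
      din + n * a := by
  have iN := integrable_of_two_thirds_le hN
  have iM (i : Fin din) := integrable_of_two_thirds_le (hM i)
  have e : ∑ i, (T.acceptProb (replacement (Fin din) θ) + T.rejectProb (perturbed θ ω a i)) =
      ∫ x, ∑ i, ((T.tester x).acceptProb (replacement (Fin din) θ) +
        (T.tester x).rejectProb (perturbed θ ω a i)) ∂T.P := by
    rw [integral_finsetSum Finset.univ (f := fun i x => (T.tester x).acceptProb
      (replacement (Fin din) θ) + (T.tester x).rejectProb (perturbed θ ω a i))
      fun i _ => iN.add (iM i)]
    exact Finset.sum_congr rfl fun i _ => (integral_add iN (iM i)).symm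
  rw [e]
  refine (integral_mono (integrable_finsetSum _ fun i _ => iN.add (iM i))
    (integrable_const ((din : ℝ) + n * a)) fun x =>
      (T.tester x).sum_acceptProb_add_rejectProb_le hd hθ hω hθ1 hω1 h0 h1).trans ?_
  simp

end RandomizedTester

end ChannelTesting

open ChannelTesting in
theorem theorem1p2 :
    ∃ c : ℝ, 0 < c ∧
      ∀ (din dout : ℕ), 2 ≤ dout →
      ∀ θ : Matrix (Fin dout) (Fin dout) ℂ, ChannelTesting.IsPureState θ →
      ∀ ε : ℝ, 0 < ε → ε ≤ 2 →
      ∀ (n : ℕ) (T : ChannelTesting.RandomizedTester din dout n),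
        T.TestsIdentity (ChannelTesting.replacement (Fin din) θ) ε →
          c * ((din : ℝ) / ε) ≤ (n : ℝ) := by
  refine ⟨2 / 3, by norm_num, fun din dout hd θ hθ ε hε0 hε2 n T hT => ?_⟩
  obtain ⟨v, hv, rfl⟩ := hθ
  obtain ⟨w, hw, hvw⟩ := exists_unit_orthogonal hd v
  have hwv : star w ⬝ᵥ v = 0 := by
    rw [star_dotProduct, hvw, star_zero]
  have hpos (u : Fin dout → ℂ) : (vecMulVec u (star u)).PosSemidef :=
    posSemidef_vecMulVec_self_star u
  have htr {u : Fin dout → ℂ} (hu : star u ⬝ᵥ u = 1) : (vecMulVec u (star u)).trace = 1 := by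
    rw [trace_vecMulVec, dotProduct_comm, hu]
  have hmul (u u' : Fin dout → ℂ) : vecMulVec u (star u) * vecMulVec u' (star u') =
      (star u ⬝ᵥ u') • vecMulVec u (star u') := by
    rw [vecMulVec_mul_vecMulVec, vecMulVec_smul]
  -- Weight `ε / 2` on the orthogonal state puts the channels at diamond distance `ε`.
  have hfar (i : Fin din) : ε ≤ diamondNorm
      (perturbed (vecMulVec v (star v)) (vecMulVec w (star w)) (ε / 2) i -
        replacement (Fin din) (vecMulVec v (star v))) := by
    have h := le_diamondNorm_perturbed_sub (hpos v).isHermitian (hpos w).isHermitian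
      (by rw [hmul, hv, one_smul]) (by rw [hmul, hw, one_smul]) (by rw [hmul, hvw, zero_smul])
      (by rw [hmul, hwv, zero_smul]) (htr hv) (htr hw) (half_pos hε0) i
    linarith
  have hrej (i : Fin din) := hT.rejects _ (isChannel_perturbed (hpos v) (hpos w) (htr hv) (htr hw)
    (by linarith) (by linarith) i) (hfar i)
  have hle := T.sum_acceptProb_add_rejectProb_le (by omega) (hpos v) (hpos w) (htr hv) (htr hw)
    (a := ε / 2) (by linarith) (by linarith) hT.accepts hrej
  have hge : (din : ℝ) * (4 / 3) ≤ ∑ i, (T.acceptProb (replacement (Fin din)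
      (vecMulVec v (star v))) + T.rejectProb
        (perturbed (vecMulVec v (star v)) (vecMulVec w (star w)) (ε / 2) i)) := by
    have h := Finset.card_nsmul_le_sum Finset.univ _ (4 / 3 : ℝ) fun i _ =>
      (by linarith [hT.accepts, hrej i] : (4 / 3 : ℝ) ≤ T.acceptProb (replacement (Fin din)
        (vecMulVec v (star v))) + T.rejectProb
          (perturbed (vecMulVec v (star v)) (vecMulVec w (star w)) (ε / 2) i))
    simpa using h
  rw [← mul_div_assoc, div_le_iff₀ hε0]
  linarith
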